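/- Let $m,K\in\mathbb N$, let $\Theta\subset\mathbb R^K$ be a finite nonempty set with cardinality $|\Theta|$, and for each $\theta\in\Theta$ let $A(\theta)\in\mathbb R^{m\times m}$ be symmetric. Write $\overline A(\theta)=A(\theta)-\operatorname{diag}(A(\theta))$ for the offdiagonal part, and $$\alpha_\xi=\max_{\theta\in\Theta}\|\overline A(\theta)\|_\xi,\qquad \xi\in\{2,F,M\},$$ where $\|\cdot\|_2$ is the spectral norm, $\|\cdot\|_F$ the Frobenius norm, and $\|B\|_M=\sum_{i,j}|b_{ij}|$. Let $N\ge 1$ and let $\omega_1,\dots,\omega_N\in\mathbb R^m$ be independent Rademacher vectors (each has independent entries equal to $1$ or $-1$ with probability $1/2$). Put $$F(\theta)=\operatorname{trace}(A(\theta)),\qquad \hat F(\theta)=\frac1N\sum_{i=1}^N\omega_i^{T}A(\theta)\,\omega_i ,$$ let $\theta^*$ be a minimizer of $F$ over $\Theta$, and let $\hat\theta$ be a (random) minimizer of $\hat F$ over $\Theta$. Let $0<\varepsilon<1$ and $0<\delta<1$. If $$N\ge\frac{8}{\varepsilon^2}\,\alpha_M^2\,\ln\!\left(\frac{|\Theta|}{\delta}\right)\qquad\text{or}\qquad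 N\ge\frac{16}{\varepsilon^2}\,\bigl(2\alpha_F^2+\varepsilon\,\alpha_2\bigr)\ln\!\left(\frac{2|\Theta|}{\delta}\right),$$ then $0\le F(\hat\theta)-F(\theta^*)<\varepsilon$ with probability at least $1-\delta$. -/

import Mathlib

open MeasureTheory ProbabilityTheory

namespace TraceOpt

/-- A random vector with independent entries, each equal to `1` or `-1` with probability `1/2`. -/
structure IsRademacherVector {Ω : Type*} [MeasurableSpace Ω] (P : Measure Ω) {m : ℕ}
    (X : Ω → Fin m → ℝ) : Prop where
  measurable : Measurable X
  indep : iIndepFun (fun (j : Fin m) (ω : Ω) => X ω j) P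
  prob_one : ∀ j, P {ω | X ω j = 1} = 1 / 2
  prob_neg_one : ∀ j, P {ω | X ω j = -1} = 1 / 2

/-- The offdiagonal part `B - diag(B)` of a square matrix. -/
def offDiag {m : ℕ} (B : Matrix (Fin m) (Fin m) ℝ) : Matrix (Fin m) (Fin m) ℝ :=
  B - Matrix.diagonal B.diag

/-- The sum of the absolute values of all entries. -/
def normM {m : ℕ} (B : Matrix (Fin m) (Fin m) ℝ) : ℝ :=
  ∑ i, ∑ j, |B i j|

/-- The Frobenius norm. -/
noncomputable def normF {m : ℕ} (B : Matrix (Fin m) (Fin m) ℝ) : ℝ :=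
  Real.sqrt (∑ i, ∑ j, B i j ^ 2)

/-- The spectral norm: the operator norm with respect to the Euclidean vector norm. -/
noncomputable def norm2 {m : ℕ} (B : Matrix (Fin m) (Fin m) ℝ) : ℝ :=
  ‖Matrix.toEuclideanCLM (n := Fin m) (𝕜 := ℝ) B‖

/-- The maximum over `θ ∈ Θ` of the given norm `ν` of the offdiagonal part of `A θ`. -/
noncomputable def alpha {E : Type*} {m : ℕ} (ν : Matrix (Fin m) (Fin m) ℝ → ℝ)
    (Θ : Finset E) (hΘ : Θ.Nonempty) (A : E → Matrix (Fin m) (Fin m) ℝ) : ℝ :=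
  Θ.sup' hΘ (fun θ => ν (offDiag (A θ)))

/-- The objective `F(θ) = trace A(θ)`. -/
def F {E : Type*} {m : ℕ} (A : E → Matrix (Fin m) (Fin m) ℝ) (θ : E) : ℝ :=
  (A θ).trace

/-- The Monte Carlo estimator `(1/N) ∑ i, wᵢᵀ A(θ) wᵢ` for the sample vectors `w`. -/
noncomputable def Fhat {E : Type*} {m N : ℕ} (A : E → Matrix (Fin m) (Fin m) ℝ)
    (w : Fin N → Fin m → ℝ) (θ : E) : ℝ :=
  (1 / (N : ℝ)) * ∑ i, w i ⬝ᵥ (A θ).mulVec (w i)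

/-- `θ₀` is a minimizer of `f` over `Θ`. -/
def IsMinimizer {E : Type*} (f : E → ℝ) (Θ : Finset E) (θ₀ : E) : Prop :=
  θ₀ ∈ Θ ∧ ∀ θ ∈ Θ, f θ₀ ≤ f θ

end TraceOpt

/-!
If `θhat` minimizes the estimator but its trace exceeds that of `θstar` by at least `ε`, then the
sum over the samples of the quadratic form of `C = offDiag (A θstar) - offDiag (A θhat)` is at least
`N * ε` (`le_sum_quadForm_of_isMinimizer`), since on `±1` vectors the diagonal part of a quadratic
form is exactly the trace. For each fixed `θ` in place of `θhat`, the probability of this deviation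
is at most `δ / |Θ|` (`measureReal_deviation_le`), and a union bound over `Θ` concludes. Working with
the difference matrix, only the upper tail of one sum is needed for each `θ`.

The tail bounds come from Chernoff's inequality (`measureReal_sum_quadForm_ge_le`) and two bounds on
the moment generating function of the chaos `xᵀ C x`, where `C` is symmetric with zero diagonal. The
one in terms of `normM` is Hoeffding's lemma. The one in terms of `normF` and `norm2`
(`average_exp_chaos_le`) rests on a comparison with Gaussian vectors: since `C` has zero diagonal,
`exp (s xᵀ C x)` is, up to a factor, the exponential of a linear function of each single coordinate,
and `cosh b ≤ exp (b² / 2)` says that replacing a sign by a standard Gaussian increases its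
expectation. The Gaussian expectation is `det (1 - 2 s C) ^ (-1/2)`. No Gaussian measure is used:
the replacement of one coordinate amounts to taking a Schur complement, so that the bound by the
determinant is an induction on the dimension (`sum_exp_signVec_le`). The determinant is then
estimated through its eigenvalues (`exp_le_det`), where the trace of `C` vanishes and the sum of the
squares of its eigenvalues is the square of the Frobenius norm.
-/

namespace TraceOpt

/-! ### The exponential moment of a Rademacher chaos -/

/-- The real vector with entries `±1` given by a family of signs. -/
def signVec {n : ℕ} (σ : Fin n → ℤˣ) : Fin n → ℝ := fun j => ((σ j : ℤ) : ℝ)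

lemma signVec_sq {n : ℕ} (σ : Fin n → ℤˣ) (j : Fin n) : signVec σ j ^ 2 = 1 := by
  rcases Int.units_eq_one_or (σ j) with h | h <;> simp [signVec, h]

lemma sum_signs_succ {n : ℕ} (g : (Fin (n + 1) → ℤˣ) → ℝ) :
    ∑ σ, g σ = ∑ σ : Fin n → ℤˣ, (g (Fin.cons 1 σ) + g (Fin.cons (-1) σ)) := by
  rw [← (Fin.consEquiv (fun _ => ℤˣ)).sum_comp, Fintype.sum_prod_type_right]
  refine Finset.sum_congr rfl fun σ _ => ?_
  have : (Finset.univ : Finset ℤˣ) = {1, -1} := rfl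
  rw [this, Finset.sum_pair (by decide)]
  rfl

lemma signVec_cons {n : ℕ} (u : ℤˣ) (σ : Fin n → ℤˣ) :
    signVec (Fin.cons u σ : Fin (n + 1) → ℤˣ) = Fin.cons ((u : ℤ) : ℝ) (signVec σ) := by
  funext j
  refine Fin.cases ?_ (fun i => ?_) j <;> simp [signVec]

/-- The Schur complement of the entry `S 0 0`. -/
noncomputable def schurZero {n : ℕ} (S : Matrix (Fin (n + 1)) (Fin (n + 1)) ℝ) :
    Matrix (Fin n) (Fin n) ℝ :=
  fun i j => S i.succ j.succ - S 0 i.succ * S 0 j.succ / S 0 0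

lemma det_eq_mul_det_schurZero {n : ℕ} {S : Matrix (Fin (n + 1)) (Fin (n + 1)) ℝ}
    (hS : S.IsSymm) (h0 : S 0 0 ≠ 0) : S.det = S 0 0 * (schurZero S).det := by
  let B : Matrix (Fin (n + 1)) (Fin (n + 1)) ℝ :=
    Fin.cons (S 0) fun i j => S i.succ j - S i.succ 0 / S 0 0 * S 0 j
  have hdet : S.det = B.det := by
    refine Matrix.det_eq_of_forall_row_eq_smul_add_const
      (Fin.cons 0 fun i => S i.succ 0 / S 0 0) 0 rfl fun i j => ?_
    refine Fin.cases ?_ (fun i => ?_) i <;> simp [B]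
  rw [hdet, Matrix.det_succ_column_zero, Fin.sum_univ_succ]
  have hcol : ∀ i : Fin n, B i.succ 0 = 0 := fun i => by
    simp only [B, Fin.cons_succ]; field_simp; ring
  have hsub : B.submatrix (Fin.succAbove 0) Fin.succ = schurZero S := by
    ext i j
    change S i.succ j.succ - S i.succ 0 / S 0 0 * S 0 j.succ =
      S i.succ j.succ - S 0 i.succ * S 0 j.succ / S 0 0
    rw [hS.apply 0 i.succ]
    ring
  have h00 : B 0 0 = S 0 0 := rfl
  rw [hsub, h00]
  simp [hcol]

/-- Completing the square in the first coordinate. -/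
lemma dotProduct_mulVec_cons {n : ℕ} {S : Matrix (Fin (n + 1)) (Fin (n + 1)) ℝ}
    (hS : S.IsSymm) (t : ℝ) (y : Fin n → ℝ) :
    (Fin.cons t y : Fin (n + 1) → ℝ) ⬝ᵥ S.mulVec (Fin.cons t y) =
      S 0 0 * t ^ 2 + 2 * t * (∑ j, S 0 j.succ * y j) + (∑ j, S 0 j.succ * y j) ^ 2 / S 0 0
        + y ⬝ᵥ (schurZero S).mulVec y := by
  simp only [dotProduct, Matrix.mulVec, Fin.sum_univ_succ, Fin.cons_zero, Fin.cons_succ,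
    schurZero, sub_mul, Finset.sum_sub_distrib, mul_sub, mul_add, Finset.sum_add_distrib]
  have h1 : ∑ i, y i * (S i.succ 0 * t) = t * ∑ j, S 0 j.succ * y j := by
    rw [Finset.mul_sum]
    exact Finset.sum_congr rfl fun i _ => by rw [hS.apply 0 i.succ]; ring
  have h2 : ∑ i, y i * ∑ j, S 0 i.succ * S 0 j.succ / S 0 0 * y j =
      (∑ j, S 0 j.succ * y j) ^ 2 / S 0 0 := by
    rw [sq, Finset.sum_mul, Finset.sum_div]
    refine Finset.sum_congr rfl fun i _ => ?_
    rw [Finset.mul_sum, Finset.mul_sum, Finset.sum_div]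
    exact Finset.sum_congr rfl fun j _ => by ring
  rw [h1, h2]
  ring

/-- With `S = 1 - 2 M` the summand is `exp (xᵀ M x)` at a sign vector `x`, and `1 / √det S` is the
expectation of `exp (xᵀ M x)` for a standard Gaussian `x`. The comparison goes one coordinate at a
time: summing over the sign of a coordinate produces a `cosh`, which is bounded by the exponential
of half the square, and this replaces `S` by its Schur complement. The condition `S i i ≤ 1` is
stable under this step. -/
lemma sum_exp_signVec_le {n : ℕ} (S : Matrix (Fin n) (Fin n) ℝ) (hS : S.IsSymm)
    (hpos : ∀ x, x ≠ 0 → 0 < x ⬝ᵥ S.mulVec x) (hdiag : ∀ i, S i i ≤ 1) :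
    0 < S.det ∧ ∑ σ, Real.exp (((n : ℝ) - signVec σ ⬝ᵥ S.mulVec (signVec σ)) / 2) ≤
      2 ^ n / Real.sqrt S.det := by
  induction n with
  | zero => simp [Matrix.det_isEmpty]
  | succ n ih =>
    have hp : 0 < S 0 0 := by
      simpa using hpos (Pi.single 0 1) (by simp)
    have hq := fun t y => dotProduct_mulVec_cons hS t y
    obtain ⟨hdet, hsum⟩ := ih (schurZero S)
      (by ext i j; simp only [Matrix.transpose_apply, schurZero, hS.apply j.succ i.succ]; ring)
      (fun y hy => by
        -- the minimum over `t` of the form at `(t, y)` is the form of the Schur complement at `y`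
        have h := hpos (Fin.cons (-(∑ j, S 0 j.succ * y j) / S 0 0) y) (fun h => hy (by
          funext i; simpa using congrFun h i.succ))
        rw [hq] at h
        convert h using 1
        field_simp
        ring)
      (fun i => by
        have : 0 ≤ S 0 i.succ * S 0 i.succ / S 0 0 := div_nonneg (mul_self_nonneg _) hp.le
        have := hdiag i.succ
        simp only [schurZero]; linarith)
    rw [det_eq_mul_det_schurZero hS hp.ne']
    refine ⟨mul_pos hp hdet, ?_⟩
    -- the Gaussian normalization `1 / √p` with `p = S 0 0` dominates the factor `exp ((1 - p) / 2)`,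
    -- as `p ≤ exp (p - 1)`
    have hsq : Real.exp ((1 - S 0 0) / 2) ≤ 1 / Real.sqrt (S 0 0) := by
      have h1 : Real.sqrt (S 0 0) ≤ Real.exp (-((1 - S 0 0) / 2)) := by
        refine Real.sqrt_le_iff.2 ⟨(Real.exp_pos _).le, ?_⟩
        rw [← Real.exp_nat_mul]
        have h2 := Real.add_one_le_exp (S 0 0 - 1)
        refine le_trans (by linarith) (h2.trans (le_of_eq ?_))
        congr 1
        push_cast
        ring
      rw [le_div_iff₀ (Real.sqrt_pos.2 hp)]
      calc _ ≤ Real.exp ((1 - S 0 0) / 2) * Real.exp (-((1 - S 0 0) / 2)) := by gcongr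
        _ = 1 := by rw [← Real.exp_add]; simp
    have hstep : ∀ σ : Fin n → ℤˣ,
        Real.exp ((((n + 1 : ℕ) : ℝ) - signVec (Fin.cons 1 σ : Fin (n + 1) → ℤˣ) ⬝ᵥ
            S.mulVec (signVec (Fin.cons 1 σ : Fin (n + 1) → ℤˣ))) / 2) +
          Real.exp ((((n + 1 : ℕ) : ℝ) - signVec (Fin.cons (-1) σ : Fin (n + 1) → ℤˣ) ⬝ᵥ
            S.mulVec (signVec (Fin.cons (-1) σ : Fin (n + 1) → ℤˣ))) / 2) ≤
        2 / Real.sqrt (S 0 0) *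
          Real.exp (((n : ℝ) - signVec σ ⬝ᵥ (schurZero S).mulVec (signVec σ)) / 2) := by
      intro σ
      rw [signVec_cons, signVec_cons, hq, hq]
      set b := ∑ j, S 0 j.succ * signVec σ j
      set q := signVec σ ⬝ᵥ (schurZero S).mulVec (signVec σ)
      have hb : b ^ 2 ≤ b ^ 2 / S 0 0 := le_div_self (sq_nonneg _) hp (hdiag 0)
      have hcosh : Real.exp b + Real.exp (-b) ≤ 2 * Real.exp (b ^ 2 / S 0 0 / 2) := by
        have h1 := Real.cosh_le_exp_half_sq b
        have h2 : Real.exp (b ^ 2 / 2) ≤ Real.exp (b ^ 2 / S 0 0 / 2) :=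
          Real.exp_le_exp.2 (by linarith)
        rw [Real.cosh_eq] at h1
        linarith
      calc _ = Real.exp ((n - q) / 2) * Real.exp ((1 - S 0 0) / 2) *
            (Real.exp (-(b ^ 2 / S 0 0 / 2)) * (Real.exp b + Real.exp (-b))) := by
            simp only [mul_add, ← Real.exp_add]
            rw [add_comm]
            push_cast
            congr 2 <;> ring
        _ ≤ Real.exp ((n - q) / 2) * (1 / Real.sqrt (S 0 0)) *
            (Real.exp (-(b ^ 2 / S 0 0 / 2)) * (2 * Real.exp (b ^ 2 / S 0 0 / 2))) := by gcongr
        _ = _ := by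
            have : Real.exp (-(b ^ 2 / S 0 0 / 2)) * Real.exp (b ^ 2 / S 0 0 / 2) = 1 := by
              rw [← Real.exp_add]; simp
            linear_combination (2 * Real.exp ((n - q) / 2) * (1 / Real.sqrt (S 0 0))) * this
    rw [sum_signs_succ]
    refine (Finset.sum_le_sum fun σ _ => hstep σ).trans ?_
    rw [← Finset.mul_sum, Real.sqrt_mul hp.le]
    calc _ ≤ 2 / Real.sqrt (S 0 0) * (2 ^ n / Real.sqrt (schurZero S).det) := by gcongr
      _ = _ := by rw [pow_succ]; field_simp

/-- For a symmetric matrix with quadratic form at least `c > 0`, the determinant is controlled by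
the trace and the Frobenius norm of `S - 1`: apply `log μ ≥ (μ - 1) - (μ - 1) ^ 2 / c` to each
eigenvalue `μ ≥ c`. -/
lemma exp_le_det {n : ℕ} (S : Matrix (Fin n) (Fin n) ℝ) (hS : S.IsSymm) {c : ℝ} (hc : 0 < c)
    (hlow : ∀ x, c * (x ⬝ᵥ x) ≤ x ⬝ᵥ S.mulVec x) :
    Real.exp ((S - 1).trace - ((S - 1) * (S - 1)).trace / c) ≤ S.det := by
  have hH : S.IsHermitian := by
    rw [Matrix.IsHermitian, Matrix.conjTranspose_eq_transpose_of_trivial]; exact hS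
  set μ := hH.eigenvalues with hμ
  have hge : ∀ i, c ≤ μ i := fun i => by
    have h := hlow ⇑(hH.eigenvectorBasis i)
    have h1 : (⇑(hH.eigenvectorBasis i) : Fin n → ℝ) ⬝ᵥ ⇑(hH.eigenvectorBasis i) = 1 := by
      have := hH.eigenvectorBasis.orthonormal.1 i
      have h2 := EuclideanSpace.real_norm_sq_eq (hH.eigenvectorBasis i)
      rw [this] at h2
      simp only [dotProduct, ← sq]
      linarith
    rw [h1, mul_one] at h
    rw [hμ, hH.eigenvalues_eq]
    simpa using h
  have htr : (S - 1).trace = ∑ i, (μ i - 1) := by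
    rw [Matrix.trace_sub, hH.trace_eq_sum_eigenvalues]
    simp [hμ]
  have htr2 : ((S - 1) * (S - 1)).trace = ∑ i, (μ i - 1) ^ 2 := by
    have hss : (S * S).trace = ∑ i, μ i ^ 2 := by
      have h := hH.spectral_theorem
      rw [h, ← map_mul, Unitary.conjStarAlgAut_apply, Matrix.trace_mul_comm, ← mul_assoc]
      simp [Matrix.trace, sq, hμ]
    have h1 : (S - 1) * (S - 1) = S * S - 2 • S + 1 := by noncomm_ring
    rw [h1, Matrix.trace_add, Matrix.trace_sub, hss, Matrix.trace_smul,
      hH.trace_eq_sum_eigenvalues]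
    simp only [sub_sq, Finset.sum_add_distrib, Finset.sum_sub_distrib]
    simp [hμ, Finset.mul_sum]
  rw [hH.det_eq_prod_eigenvalues, htr, htr2, Finset.sum_div, ← Finset.sum_sub_distrib,
    Real.exp_sum]
  refine Finset.prod_le_prod (fun i _ => (Real.exp_pos _).le) fun i _ => ?_
  have hpos : 0 < μ i := hc.trans_le (hge i)
  change _ ≤ μ i
  rw [← Real.le_log_iff_exp_le hpos]
  have h1 := Real.one_sub_inv_le_log_of_pos hpos
  have h2 : (μ i - 1) ^ 2 / μ i ≤ (μ i - 1) ^ 2 / c := by gcongr; exact hge i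
  have h3 : 1 - (μ i)⁻¹ = (μ i - 1) - (μ i - 1) ^ 2 / μ i := by field_simp; ring
  linarith

lemma abs_dotProduct_mulVec_le {n : ℕ} (C : Matrix (Fin n) (Fin n) ℝ) (x : Fin n → ℝ) :
    |x ⬝ᵥ C.mulVec x| ≤ norm2 C * (x ⬝ᵥ x) := by
  have h := Matrix.inner_toEuclideanCLM C (WithLp.toLp 2 x) (WithLp.toLp 2 x)
  simp only at h
  rw [← h]
  refine (abs_real_inner_le_norm _ _).trans ?_
  have h2 : x ⬝ᵥ x = ‖WithLp.toLp 2 x‖ ^ 2 := by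
    rw [EuclideanSpace.real_norm_sq_eq]; simp [dotProduct, sq]
  have h3 := (Matrix.toEuclideanCLM (n := Fin n) (𝕜 := ℝ) C).le_opNorm (WithLp.toLp 2 x)
  rw [h2, norm2]
  calc _ ≤ ‖WithLp.toLp 2 x‖ * (‖Matrix.toEuclideanCLM (n := Fin n) (𝕜 := ℝ) C‖ *
        ‖WithLp.toLp 2 x‖) := by gcongr
    _ = _ := by ring

lemma normF_sq {n : ℕ} (B : Matrix (Fin n) (Fin n) ℝ) :
    normF B ^ 2 = ∑ i, ∑ j, B i j ^ 2 :=
  Real.sq_sqrt (Finset.sum_nonneg fun _ _ => Finset.sum_nonneg fun _ _ => sq_nonneg _)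

/-- The moment generating function of the Rademacher chaos of a symmetric matrix with zero
diagonal, as an average over sign vectors. -/
lemma average_exp_chaos_le {n : ℕ} (C : Matrix (Fin n) (Fin n) ℝ) (hC : C.IsSymm)
    (hdiag : ∀ i, C i i = 0) {s : ℝ} (hs : 0 ≤ s) (hs1 : 2 * s * norm2 C < 1) :
    (∑ σ, Real.exp (s * (signVec σ ⬝ᵥ C.mulVec (signVec σ)))) / 2 ^ n ≤
      Real.exp (2 * s ^ 2 * normF C ^ 2 / (1 - 2 * s * norm2 C)) := by
  set S : Matrix (Fin n) (Fin n) ℝ := 1 - (2 * s) • C with hSdef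
  set c := 1 - 2 * s * norm2 C with hc
  have hc0 : 0 < c := by linarith
  have hS : S.IsSymm := by
    rw [hSdef]; exact Matrix.isSymm_one.sub (hC.smul _)
  have hform : ∀ x, x ⬝ᵥ S.mulVec x = x ⬝ᵥ x - 2 * s * (x ⬝ᵥ C.mulVec x) := fun x => by
    simp [hSdef, Matrix.sub_mulVec, Matrix.smul_mulVec]
  have hlow : ∀ x, c * (x ⬝ᵥ x) ≤ x ⬝ᵥ S.mulVec x := fun x => by
    have h := (abs_le.1 (abs_dotProduct_mulVec_le C x)).2
    have := mul_le_mul_of_nonneg_left h (by linarith : 0 ≤ 2 * s)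
    rw [hform, hc]
    linarith
  obtain ⟨hdet, hsum⟩ := sum_exp_signVec_le S hS
    (fun x hx => (mul_pos hc0 (by
      have h0 : 0 ≤ x ⬝ᵥ x := Finset.sum_nonneg fun i _ => mul_self_nonneg (x i)
      exact lt_of_le_of_ne h0 fun h => hx (dotProduct_self_eq_zero.1 h.symm))).trans_le (hlow x))
    (fun i => by simp [hSdef, hdiag])
  have htr : (S - 1).trace = 0 := by simp [hSdef, Matrix.trace, hdiag]
  have htr2 : ((S - 1) * (S - 1)).trace = 4 * s ^ 2 * normF C ^ 2 := by
    rw [normF_sq, Finset.mul_sum]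
    simp only [hSdef, sub_sub_cancel_left, Matrix.trace, Matrix.diag, Matrix.mul_apply,
      Matrix.neg_apply, Matrix.smul_apply, smul_eq_mul]
    refine Finset.sum_congr rfl fun i _ => ?_
    rw [Finset.mul_sum]
    exact Finset.sum_congr rfl fun j _ => by rw [hC.apply i j]; ring
  have hexp := exp_le_det S hS hc0 hlow
  rw [htr, htr2] at hexp
  have hsqrt : Real.exp (-(2 * s ^ 2 * normF C ^ 2 / c)) ≤ Real.sqrt S.det := by
    refine Real.le_sqrt_of_sq_le (le_trans (le_of_eq ?_) hexp)
    rw [← Real.exp_nat_mul]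
    congr 1
    push_cast
    ring
  have hval : ∀ σ : Fin n → ℤˣ, s * (signVec σ ⬝ᵥ C.mulVec (signVec σ)) =
      ((n : ℝ) - signVec σ ⬝ᵥ S.mulVec (signVec σ)) / 2 := fun σ => by
    have : signVec σ ⬝ᵥ signVec σ = n := by simp [dotProduct, ← sq, signVec_sq]
    rw [hform, this]
    ring
  simp only [hval]
  rw [div_le_iff₀ (by positivity)]
  refine hsum.trans ?_
  rw [div_le_iff₀ (Real.sqrt_pos.2 hdet)]
  calc (2 : ℝ) ^ n = Real.exp (2 * s ^ 2 * normF C ^ 2 / c) * 2 ^ n *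
        Real.exp (-(2 * s ^ 2 * normF C ^ 2 / c)) := by
        rw [mul_right_comm, ← Real.exp_add]; simp
    _ ≤ _ := by gcongr

/-! ### Quadratic forms of a Rademacher vector -/

section Rademacher

variable {Ω : Type*} [MeasurableSpace Ω] {P : Measure Ω} {m : ℕ}
  {X : Ω → Fin m → ℝ}

lemma IsRademacherVector.measurable_apply (hX : IsRademacherVector P X) (j : Fin m) :
    Measurable fun ω => X ω j :=
  (measurable_pi_apply j).comp hX.measurable

lemma IsRademacherVector.ae_eq_one_or_neg_one [IsProbabilityMeasure P]
    (hX : IsRademacherVector P X) :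
    ∀ᵐ ω ∂P, ∀ j, X ω j = 1 ∨ X ω j = -1 := by
  rw [ae_all_iff]
  intro j
  have hm := hX.measurable_apply j
  have h1 : MeasurableSet {ω | X ω j = 1} := hm (measurableSet_singleton 1)
  have h2 : MeasurableSet {ω | X ω j = -1} := hm (measurableSet_singleton (-1))
  have hd : Disjoint {ω | X ω j = 1} {ω | X ω j = -1} :=
    Set.disjoint_left.2 fun ω (h : X ω j = 1) (h' : X ω j = -1) => by linarith
  have hu : P ({ω | X ω j = 1} ∪ {ω | X ω j = -1}) = 1 := by
    rw [measure_union hd h2, hX.prob_one, hX.prob_neg_one, ENNReal.add_halves]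
  exact (prob_compl_eq_zero_iff (h1.union h2)).2 hu

lemma signVec_injective : Function.Injective (signVec : (Fin m → ℤˣ) → Fin m → ℝ) :=
  fun σ τ h => funext fun j => by
    have := congrFun h j
    simp only [signVec] at this
    exact Units.ext (by exact_mod_cast this)

lemma exists_signVec_eq {x : Fin m → ℝ} (hx : ∀ j, x j = 1 ∨ x j = -1) :
    ∃ σ : Fin m → ℤˣ, x = signVec σ := by
  choose σ hσ using fun j => show ∃ u : ℤˣ, x j = ((u : ℤ) : ℝ) by
    rcases hx j with h | h
    · exact ⟨1, by simp [h]⟩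
    · exact ⟨-1, by simp [h]⟩
  exact ⟨σ, funext hσ⟩

lemma IsRademacherVector.measureReal_eq_signVec (hX : IsRademacherVector P X)
    (σ : Fin m → ℤˣ) : P.real {ω | X ω = signVec σ} = 1 / 2 ^ m := by
  have hset : {ω | X ω = signVec σ} = ⋂ j ∈ Finset.univ, (fun ω => X ω j) ⁻¹' {signVec σ j} := by
    ext ω
    simp [funext_iff]
  have hj : ∀ j, P ((fun ω => X ω j) ⁻¹' {signVec σ j}) = 1 / 2 := fun j => by
    rcases Int.units_eq_one_or (σ j) with h | h
    · simpa [signVec, h, Set.preimage] using hX.prob_one j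
    · simpa [signVec, h, Set.preimage] using hX.prob_neg_one j
  rw [measureReal_def, hset, hX.indep.measure_inter_preimage_eq_mul Finset.univ
    fun j _ => measurableSet_singleton _]
  simp [hj]

/-- A Rademacher vector is uniformly distributed on the sign vectors. -/
lemma IsRademacherVector.integral_eq_average [IsProbabilityMeasure P]
    (hX : IsRademacherVector P X)
    (g : (Fin m → ℝ) → ℝ) : ∫ ω, g (X ω) ∂P = (∑ σ, g (signVec σ)) / 2 ^ m := by
  have hms : ∀ σ : Fin m → ℤˣ, MeasurableSet {ω | X ω = signVec σ} :=
    fun σ => hX.measurable (measurableSet_singleton _)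
  have hae : (fun ω => g (X ω)) =ᵐ[P]
      fun ω => ∑ σ, {ω | X ω = signVec σ}.indicator (fun _ => g (signVec σ)) ω := by
    filter_upwards [hX.ae_eq_one_or_neg_one] with ω hω
    obtain ⟨τ, hτ⟩ := exists_signVec_eq hω
    rw [Finset.sum_eq_single τ]
    · simp [hτ]
    · intro σ _ hσ
      refine Set.indicator_of_notMem (fun h => hσ ?_) _
      exact signVec_injective (h.symm.trans hτ)
    · simp
  rw [integral_congr_ae hae, integral_finsetSum _ fun σ _ =>
    (integrable_const _).indicator (hms σ), Finset.sum_div]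
  refine Finset.sum_congr rfl fun σ _ => ?_
  rw [integral_indicator_const _ (hms σ), hX.measureReal_eq_signVec]
  simp [div_eq_inv_mul]

lemma sum_signVec_mul_eq_zero {i j : Fin m} (hij : i ≠ j) :
    ∑ σ : Fin m → ℤˣ, signVec σ i * signVec σ j = 0 := by
  -- flipping the sign of coordinate `i` changes the sign of every summand
  have h := Equiv.sum_comp (Equiv.mulLeft (Pi.mulSingle i (-1 : ℤˣ) : Fin m → ℤˣ))
    fun σ => signVec σ i * signVec σ j
  simp only [Equiv.coe_mulLeft, signVec, Pi.mul_apply, Pi.mulSingle_eq_same,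
    Pi.mulSingle_eq_of_ne hij.symm] at h
  simp only [one_mul, neg_mul, Units.val_neg, Int.cast_neg, Finset.sum_neg_distrib] at h
  simp only [signVec]
  linarith

lemma measurable_quadForm (hX : Measurable X) (C : Matrix (Fin m) (Fin m) ℝ) :
    Measurable fun ω => X ω ⬝ᵥ C.mulVec (X ω) := by
  have hj : ∀ j, Measurable fun ω => X ω j := fun j => (measurable_pi_apply j).comp hX
  simp only [dotProduct, Matrix.mulVec]
  fun_prop

lemma IsRademacherVector.integral_quadForm_eq_zero [IsProbabilityMeasure P]
    (hX : IsRademacherVector P X)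
    {C : Matrix (Fin m) (Fin m) ℝ} (hdiag : ∀ i, C i i = 0) :
    ∫ ω, X ω ⬝ᵥ C.mulVec (X ω) ∂P = 0 := by
  rw [hX.integral_eq_average fun x => x ⬝ᵥ C.mulVec x]
  simp only [dotProduct, Matrix.mulVec, Finset.mul_sum]
  rw [Finset.sum_comm, Finset.sum_eq_zero, zero_div]
  intro i _
  rw [Finset.sum_comm]
  refine Finset.sum_eq_zero fun j _ => ?_
  rcases eq_or_ne i j with rfl | hij
  · simp [hdiag]
  · rw [Finset.sum_congr rfl fun σ _ => show signVec σ i * (C i j * signVec σ j) =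
      C i j * (signVec σ i * signVec σ j) by ring, ← Finset.mul_sum,
      sum_signVec_mul_eq_zero hij, mul_zero]

lemma abs_quadForm_le_normM {x : Fin m → ℝ} (hx : ∀ j, x j = 1 ∨ x j = -1)
    (C : Matrix (Fin m) (Fin m) ℝ) : |x ⬝ᵥ C.mulVec x| ≤ normM C := by
  have habs : ∀ j, |x j| = 1 := fun j => by rcases hx j with h | h <;> simp [h]
  simp only [dotProduct, Matrix.mulVec, normM]
  refine (Finset.abs_sum_le_sum_abs _ _).trans (Finset.sum_le_sum fun i _ => ?_)
  rw [abs_mul, habs, one_mul]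
  refine (Finset.abs_sum_le_sum_abs _ _).trans (Finset.sum_le_sum fun j _ => ?_)
  rw [abs_mul, habs, mul_one]

lemma IsRademacherVector.ae_quadForm_mem_Icc [IsProbabilityMeasure P]
    (hX : IsRademacherVector P X)
    {C : Matrix (Fin m) (Fin m) ℝ} {b : ℝ} (hb : normM C ≤ b) :
    ∀ᵐ ω ∂P, X ω ⬝ᵥ C.mulVec (X ω) ∈ Set.Icc (-b) b := by
  filter_upwards [hX.ae_eq_one_or_neg_one] with ω hω
  exact abs_le.1 ((abs_quadForm_le_normM hω C).trans hb)

/-- Hoeffding's lemma for the quadratic form, which is centered and bounded by `normM C`. -/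
lemma IsRademacherVector.mgf_quadForm_le_normM [IsProbabilityMeasure P]
    (hX : IsRademacherVector P X)
    {C : Matrix (Fin m) (Fin m) ℝ} (hdiag : ∀ i, C i i = 0) {b : ℝ} (hb : normM C ≤ b) (s : ℝ) :
    mgf (fun ω => X ω ⬝ᵥ C.mulVec (X ω)) P s ≤ Real.exp (b ^ 2 * s ^ 2 / 2) := by
  have h := (hasSubgaussianMGF_of_mem_Icc_of_integral_eq_zero
    (measurable_quadForm hX.measurable C).aemeasurable (hX.ae_quadForm_mem_Icc hb)
    (hX.integral_quadForm_eq_zero hdiag)).mgf_le s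
  refine h.trans (le_of_eq ?_)
  congr 1
  simp only [NNReal.coe_pow, NNReal.coe_div, coe_nnnorm, Real.norm_eq_abs, div_pow, sq_abs,
    NNReal.coe_ofNat]
  ring

lemma IsRademacherVector.mgf_quadForm_le_normF [IsProbabilityMeasure P]
    (hX : IsRademacherVector P X)
    {C : Matrix (Fin m) (Fin m) ℝ} (hC : C.IsSymm) (hdiag : ∀ i, C i i = 0) {s : ℝ} (hs : 0 ≤ s)
    (hs1 : 2 * s * norm2 C < 1) :
    mgf (fun ω => X ω ⬝ᵥ C.mulVec (X ω)) P s ≤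
      Real.exp (2 * s ^ 2 * normF C ^ 2 / (1 - 2 * s * norm2 C)) := by
  rw [mgf, hX.integral_eq_average fun x => Real.exp (s * (x ⬝ᵥ C.mulVec x))]
  exact average_exp_chaos_le C hC hdiag hs hs1

end Rademacher

/-! ### Tails of sums of independent quadratic forms -/

section Tails

variable {Ω : Type*} [MeasurableSpace Ω] {P : Measure Ω} [IsProbabilityMeasure P] {m N : ℕ}
  {w : Fin N → Ω → Fin m → ℝ}

/-- Chernoff's bound for a sum of independent quadratic forms. -/
lemma measureReal_sum_quadForm_ge_le (hw : ∀ i, IsRademacherVector P (w i))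
    (hindep : iIndepFun w P) (C : Matrix (Fin m) (Fin m) ℝ) {s ψ : ℝ} (hs : 0 ≤ s)
    (hmgf : ∀ i, mgf (fun ω => w i ω ⬝ᵥ C.mulVec (w i ω)) P s ≤ Real.exp ψ) (ε : ℝ) :
    P.real {ω | N * ε ≤ ∑ i, w i ω ⬝ᵥ C.mulVec (w i ω)} ≤ Real.exp (-(N * (s * ε - ψ))) := by
  set Y : Fin N → Ω → ℝ := fun i ω => w i ω ⬝ᵥ C.mulVec (w i ω)
  have hYm : ∀ i, Measurable (Y i) := fun i => measurable_quadForm (hw i).measurable C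
  have hYind : iIndepFun Y P :=
    hindep.comp (fun _ x => x ⬝ᵥ C.mulVec x) fun _ => measurable_quadForm measurable_id C
  have hYint : ∀ i ∈ Finset.univ, Integrable (fun ω => Real.exp (s * Y i ω)) P := fun i _ =>
    integrable_exp_mul_of_mem_Icc (hYm i).aemeasurable ((hw i).ae_quadForm_mem_Icc le_rfl)
  have h := measure_ge_le_exp_mul_mgf (μ := P) (N * ε) hs
    (hYind.integrable_exp_mul_sum hYm hYint)
  simp only [Finset.sum_apply] at h
  refine h.trans ?_
  rw [hYind.mgf_sum hYm]
  calc _ ≤ Real.exp (-s * (N * ε)) * ∏ _i : Fin N, Real.exp ψ := by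
        gcongr with i
        · exact fun _ _ => mgf_nonneg
        · exact hmgf i
    _ = _ := by
        rw [Finset.prod_const, Finset.card_univ, Fintype.card_fin, ← Real.exp_nat_mul,
          ← Real.exp_add]
        congr 1
        ring

lemma measureReal_sum_quadForm_ge_le_normM (hw : ∀ i, IsRademacherVector P (w i))
    (hindep : iIndepFun w P) {C : Matrix (Fin m) (Fin m) ℝ} (hdiag : ∀ i, C i i = 0)
    {a ε : ℝ} (ha : 0 < a) (hε : 0 < ε) (hCM : normM C ≤ 2 * a) :
    P.real {ω | N * ε ≤ ∑ i, w i ω ⬝ᵥ C.mulVec (w i ω)} ≤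
      Real.exp (-(N * (ε ^ 2 / (8 * a ^ 2)))) := by
  have h := measureReal_sum_quadForm_ge_le hw hindep C (s := ε / (4 * a ^ 2)) (by positivity)
    (fun i => (hw i).mgf_quadForm_le_normM hdiag hCM _) ε
  refine h.trans (le_of_eq ?_)
  congr 3
  field_simp
  ring

lemma measureReal_sum_quadForm_ge_le_normF (hw : ∀ i, IsRademacherVector P (w i))
    (hindep : iIndepFun w P) {C : Matrix (Fin m) (Fin m) ℝ} (hC : C.IsSymm)
    (hdiag : ∀ i, C i i = 0) {f a ε : ℝ} (hf : 0 < f) (hε : 0 < ε)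
    (hCF : normF C ^ 2 ≤ 4 * f ^ 2) (hC2 : norm2 C ≤ 2 * a) :
    P.real {ω | N * ε ≤ ∑ i, w i ω ⬝ᵥ C.mulVec (w i ω)} ≤
      Real.exp (-(N * (ε ^ 2 / (16 * (2 * f ^ 2 + ε * a))))) := by
  have ha : 0 ≤ a := by
    have : 0 ≤ norm2 C := norm_nonneg _
    linarith
  -- Bernstein's choice `s = ε / (v + c ε)` for the exponent `s ε - s² v / (2 (1 - c s))`, which then
  -- equals `ε² / (2 (v + c ε))`, with `v = 16 f²` and `c = 4 a`
  set s := ε / (16 * f ^ 2 + 4 * a * ε) with hsdef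
  have hs : 0 < s := by positivity
  have h1 : 1 - 4 * a * s = 16 * f ^ 2 / (16 * f ^ 2 + 4 * a * ε) := by
    rw [hsdef]; field_simp; ring
  have h1pos : 0 < 1 - 4 * a * s := by rw [h1]; positivity
  have h2 : 1 - 4 * a * s ≤ 1 - 2 * s * norm2 C := by nlinarith
  have h := measureReal_sum_quadForm_ge_le hw hindep C (ψ := 8 * s ^ 2 * f ^ 2 / (1 - 4 * a * s))
    hs.le (fun i => ((hw i).mgf_quadForm_le_normF hC hdiag hs.le (by linarith)).trans
      (Real.exp_le_exp.2 (div_le_div₀ (by positivity)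
        (by nlinarith [mul_le_mul_of_nonneg_left hCF (by positivity : 0 ≤ 2 * s ^ 2)])
        h1pos h2))) ε
  refine h.trans (Real.exp_le_exp.2 (neg_le_neg (mul_le_mul_of_nonneg_left ?_ N.cast_nonneg)))
  have hval : s * ε - 8 * s ^ 2 * f ^ 2 / (1 - 4 * a * s) =
      ε ^ 2 / (2 * (16 * f ^ 2 + 4 * a * ε)) := by
    rw [h1, hsdef]; field_simp; ring
  rw [hval]
  have : 0 ≤ a * ε := by positivity
  exact div_le_div_of_nonneg_left (by positivity) (by positivity) (by nlinarith)

end Tails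

/-! ### Offdiagonal parts and their norms -/

section MatrixNorms

variable {m : ℕ}

lemma offDiag_apply_self (B : Matrix (Fin m) (Fin m) ℝ) (i : Fin m) : offDiag B i i = 0 := by
  simp [offDiag]

lemma isSymm_offDiag {B : Matrix (Fin m) (Fin m) ℝ} (hB : B.IsSymm) : (offDiag B).IsSymm :=
  hB.sub (Matrix.isSymm_diagonal _)

lemma quadForm_eq_trace_add {x : Fin m → ℝ} (hx : ∀ j, x j = 1 ∨ x j = -1)
    (B : Matrix (Fin m) (Fin m) ℝ) :
    x ⬝ᵥ B.mulVec x = B.trace + x ⬝ᵥ (offDiag B).mulVec x := by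
  have hsq : ∀ j, x j * (B j j * x j) = B j j := fun j => by
    rcases hx j with h | h <;> simp [h]
  have hd : x ⬝ᵥ (Matrix.diagonal B.diag).mulVec x = B.trace := by
    simp only [dotProduct, Matrix.mulVec_diagonal, Matrix.diag_apply, hsq, Matrix.trace]
  rw [offDiag, Matrix.sub_mulVec, dotProduct_sub, hd]
  ring

lemma normM_sub_le (B C : Matrix (Fin m) (Fin m) ℝ) : normM (B - C) ≤ normM B + normM C := by
  simp only [normM, ← Finset.sum_add_distrib]
  exact Finset.sum_le_sum fun i _ => Finset.sum_le_sum fun j _ => abs_sub _ _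

lemma norm2_sub_le (B C : Matrix (Fin m) (Fin m) ℝ) : norm2 (B - C) ≤ norm2 B + norm2 C := by
  rw [norm2, map_sub]
  exact norm_sub_le _ _

lemma normF_sub_sq_le (B C : Matrix (Fin m) (Fin m) ℝ) :
    normF (B - C) ^ 2 ≤ 2 * normF B ^ 2 + 2 * normF C ^ 2 := by
  simp only [normF_sq, Finset.mul_sum, ← Finset.sum_add_distrib]
  refine Finset.sum_le_sum fun i _ => Finset.sum_le_sum fun j _ => ?_
  rw [Matrix.sub_apply]
  nlinarith [sq_nonneg (B i j + C i j)]

lemma normM_nonneg (B : Matrix (Fin m) (Fin m) ℝ) : 0 ≤ normM B :=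
  Finset.sum_nonneg fun _ _ => Finset.sum_nonneg fun _ _ => abs_nonneg _

lemma normF_nonneg (B : Matrix (Fin m) (Fin m) ℝ) : 0 ≤ normF B := Real.sqrt_nonneg _

lemma eq_zero_of_normM_le_zero {B : Matrix (Fin m) (Fin m) ℝ} (h : normM B ≤ 0) : B = 0 := by
  ext i j
  have h1 : |B i j| ≤ ∑ j, |B i j| :=
    Finset.single_le_sum (f := fun j => |B i j|) (fun _ _ => abs_nonneg _) (Finset.mem_univ j)
  have h2 : ∑ j, |B i j| ≤ normM B :=
    Finset.single_le_sum (f := fun i => ∑ j, |B i j|)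
      (fun _ _ => Finset.sum_nonneg fun _ _ => abs_nonneg _) (Finset.mem_univ i)
  exact abs_nonpos_iff.1 (by linarith)

lemma eq_zero_of_normF_le_zero {B : Matrix (Fin m) (Fin m) ℝ} (h : normF B ≤ 0) : B = 0 := by
  have h0 : normF B ^ 2 = 0 := by rw [le_antisymm h (normF_nonneg B)]; simp
  rw [normF_sq] at h0
  ext i j
  have h1 := (Finset.sum_eq_zero_iff_of_nonneg
    (fun i _ => Finset.sum_nonneg fun j _ => sq_nonneg (B i j))).1 h0 i (Finset.mem_univ i)
  have h2 := (Finset.sum_eq_zero_iff_of_nonneg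
    (fun j _ => sq_nonneg (B i j))).1 h1 j (Finset.mem_univ j)
  exact pow_eq_zero_iff two_ne_zero |>.1 h2

lemma le_alpha {E : Type*} (ν : Matrix (Fin m) (Fin m) ℝ → ℝ) {Θ : Finset E} (hΘ : Θ.Nonempty)
    (A : E → Matrix (Fin m) (Fin m) ℝ) {θ : E} (hθ : θ ∈ Θ) :
    ν (offDiag (A θ)) ≤ alpha ν Θ hΘ A :=
  Finset.le_sup' (fun θ => ν (offDiag (A θ))) hθ

end MatrixNorms

lemma exp_neg_le_of_log_le {c δ M t : ℝ} (hc : 0 < c) (hδ : 0 < δ) (hcM : c ≤ M)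
    (h : Real.log (M / δ) ≤ t) : Real.exp (-t) ≤ δ / c := by
  have hM : 0 < M := hc.trans_le hcM
  have h1 : Real.exp (-t) ≤ Real.exp (-Real.log (M / δ)) := Real.exp_le_exp.2 (by linarith)
  rw [Real.exp_neg (Real.log _), Real.exp_log (by positivity), inv_div] at h1
  exact h1.trans (by gcongr)

/-! ### Comparing minimizers of the trace and of its estimator -/

section Minimizers

variable {Ω : Type*} [MeasurableSpace Ω] {P : Measure Ω} [IsProbabilityMeasure P] {m N : ℕ}
  {w : Fin N → Ω → Fin m → ℝ} {E : Type*} {Θ : Finset E} {A : E → Matrix (Fin m) (Fin m) ℝ}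

/-- Under the sample size condition, the deviation event comparing two given points of `Θ` has
probability at most `δ / |Θ|`. Passing to the difference of the offdiagonal parts at most doubles
each of the three norms. -/
lemma measureReal_deviation_le (hN : 1 ≤ N) (hΘ : Θ.Nonempty) (hA : ∀ θ ∈ Θ, (A θ).IsSymm)
    (hw : ∀ i, IsRademacherVector P (w i)) (hindep : iIndepFun w P) {ε δ : ℝ} (hε : 0 < ε)
    (hδ : 0 < δ)
    (hsample :
      (N : ℝ) ≥ 8 / ε ^ 2 * alpha normM Θ hΘ A ^ 2 * Real.log ((Θ.card : ℝ) / δ) ∨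
      (N : ℝ) ≥ 16 / ε ^ 2 * (2 * alpha normF Θ hΘ A ^ 2 + ε * alpha norm2 Θ hΘ A)
          * Real.log (2 * (Θ.card : ℝ) / δ))
    {θ θ' : E} (hθ : θ ∈ Θ) (hθ' : θ' ∈ Θ) :
    P.real {ω | N * ε ≤ ∑ i, w i ω ⬝ᵥ (offDiag (A θ) - offDiag (A θ')).mulVec (w i ω)} ≤
      δ / Θ.card := by
  have hcard : (0 : ℝ) < Θ.card := by exact_mod_cast hΘ.card_pos
  have hNε : 0 < N * ε := mul_pos (by exact_mod_cast hN) hε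
  set C := offDiag (A θ) - offDiag (A θ')
  have hdiag : ∀ i, C i i = 0 := fun i => by simp [C, offDiag_apply_self]
  -- if the offdiagonal parts vanish, the deviation event is empty
  have hzero : (∀ θ ∈ Θ, offDiag (A θ) = 0) →
      P.real {ω | N * ε ≤ ∑ i, w i ω ⬝ᵥ C.mulVec (w i ω)} ≤ δ / Θ.card := fun h => by
    have hC0 : C = 0 := by simp only [C, h θ hθ, h θ' hθ', sub_zero]
    simp only [hC0, Matrix.zero_mulVec, dotProduct_zero, Finset.sum_const_zero, not_le.2 hNε,
      Set.ofPred_false, measureReal_empty]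
    positivity
  rcases hsample with hs | hs
  · set a := alpha normM Θ hΘ A
    have hle : ∀ θ ∈ Θ, normM (offDiag (A θ)) ≤ a := fun θ h => le_alpha normM hΘ A h
    have ha0 : 0 ≤ a := (normM_nonneg _).trans (hle θ hθ)
    rcases ha0.eq_or_lt with ha | ha
    · exact hzero fun θ h => eq_zero_of_normM_le_zero (ha ▸ hle θ h)
    refine (measureReal_sum_quadForm_ge_le_normM hw hindep hdiag ha hε
      ((normM_sub_le _ _).trans (by linarith [hle θ hθ, hle θ' hθ']))).trans
      (exp_neg_le_of_log_le hcard hδ le_rfl ?_)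
    calc _ = 8 / ε ^ 2 * a ^ 2 * Real.log ((Θ.card : ℝ) / δ) * (ε ^ 2 / (8 * a ^ 2)) := by
          field_simp
      _ ≤ _ := by gcongr
  · set f := alpha normF Θ hΘ A
    set a := alpha norm2 Θ hΘ A
    have hle : ∀ θ ∈ Θ, normF (offDiag (A θ)) ≤ f := fun θ h => le_alpha normF hΘ A h
    have hle2 : ∀ θ ∈ Θ, norm2 (offDiag (A θ)) ≤ a := fun θ h => le_alpha norm2 hΘ A h
    have hf0 : 0 ≤ f := (normF_nonneg _).trans (hle θ hθ)
    have ha0 : 0 ≤ a := (norm_nonneg _).trans (hle2 θ hθ)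
    rcases hf0.eq_or_lt with hf | hf
    · exact hzero fun θ h => eq_zero_of_normF_le_zero (hf ▸ hle θ h)
    have hsq : ∀ θ ∈ Θ, normF (offDiag (A θ)) ^ 2 ≤ f ^ 2 := fun θ h =>
      pow_le_pow_left₀ (normF_nonneg _) (hle θ h) 2
    refine (measureReal_sum_quadForm_ge_le_normF (a := a) hw hindep
      ((isSymm_offDiag (hA θ hθ)).sub (isSymm_offDiag (hA θ' hθ'))) hdiag hf hε
      ((normF_sub_sq_le _ _).trans (by linarith [hsq θ hθ, hsq θ' hθ']))
      ((norm2_sub_le _ _).trans (by linarith [hle2 θ hθ, hle2 θ' hθ']))).trans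
      (exp_neg_le_of_log_le hcard hδ (by linarith : (Θ.card : ℝ) ≤ 2 * Θ.card) ?_)
    have hq : 0 < 2 * f ^ 2 + ε * a := by positivity
    calc _ = 16 / ε ^ 2 * (2 * f ^ 2 + ε * a) * Real.log (2 * (Θ.card : ℝ) / δ) *
          (ε ^ 2 / (16 * (2 * f ^ 2 + ε * a))) := by
          field_simp
      _ ≤ _ := by gcongr

/-- On sign vectors the diagonal parts contribute exactly `N` times the traces, so a point whose true
gap to `θstar` is at least `ε` can only beat `θstar` in the estimator through a deviation of at least
`N * ε` in the chaos of the difference of the two offdiagonal parts. -/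
lemma le_sum_quadForm_of_isMinimizer (hN : 1 ≤ N) {x : Fin N → Fin m → ℝ}
    (hx : ∀ i j, x i j = 1 ∨ x i j = -1) {θstar θhat : E} {ε : ℝ}
    (hle : Fhat A x θhat ≤ Fhat A x θstar) (hgap : ε ≤ F A θhat - F A θstar) :
    N * ε ≤ ∑ i, x i ⬝ᵥ (offDiag (A θstar) - offDiag (A θhat)).mulVec (x i) := by
  have hN0 : (0 : ℝ) < N := by exact_mod_cast hN
  have hsum : ∀ θ, ∑ i, x i ⬝ᵥ (A θ).mulVec (x i) =
      N * F A θ + ∑ i, x i ⬝ᵥ (offDiag (A θ)).mulVec (x i) := fun θ => by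
    rw [Finset.sum_congr rfl fun i _ => quadForm_eq_trace_add (hx i) (A θ),
      Finset.sum_add_distrib]
    simp [F]
  have h := le_of_mul_le_mul_left hle (by positivity)
  rw [hsum, hsum] at h
  simp only [Matrix.sub_mulVec, dotProduct_sub, Finset.sum_sub_distrib]
  nlinarith

end Minimizers

end TraceOpt

/-- The conclusion gives a measurable event of probability at least `1 - δ` on which the bound
holds, so no measurability of the (not necessarily unique) minimizer `θhat` is assumed. -/
theorem theorem4p2 {Ω : Type*} [MeasurableSpace Ω] (P : Measure Ω) [IsProbabilityMeasure P]
    (K m N : ℕ) (hN : 1 ≤ N)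
    (Θ : Finset (EuclideanSpace ℝ (Fin K))) (hΘ : Θ.Nonempty)
    (A : EuclideanSpace ℝ (Fin K) → Matrix (Fin m) (Fin m) ℝ)
    (hA : ∀ θ ∈ Θ, (A θ).IsSymm)
    (w : Fin N → Ω → Fin m → ℝ)
    (hw : ∀ i, TraceOpt.IsRademacherVector P (w i))
    (hindep : iIndepFun w P)
    (θstar : EuclideanSpace ℝ (Fin K))
    (hstar : TraceOpt.IsMinimizer (TraceOpt.F A) Θ θstar)
    (θhat : Ω → EuclideanSpace ℝ (Fin K))
    (hhat : ∀ ω, TraceOpt.IsMinimizer (TraceOpt.Fhat A (fun i => w i ω)) Θ (θhat ω))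
    (ε δ : ℝ) (hε : 0 < ε) (hε1 : ε < 1) (hδ : 0 < δ) (hδ1 : δ < 1)
    (hsample :
      (N : ℝ) ≥ 8 / ε ^ 2 * TraceOpt.alpha TraceOpt.normM Θ hΘ A ^ 2
          * Real.log ((Θ.card : ℝ) / δ) ∨
      (N : ℝ) ≥ 16 / ε ^ 2 * (2 * TraceOpt.alpha TraceOpt.normF Θ hΘ A ^ 2
          + ε * TraceOpt.alpha TraceOpt.norm2 Θ hΘ A)
          * Real.log (2 * (Θ.card : ℝ) / δ)) :
    ∃ G : Set Ω, MeasurableSet G ∧ 1 - δ ≤ P.real G ∧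
      ∀ ω ∈ G, 0 ≤ TraceOpt.F A (θhat ω) - TraceOpt.F A θstar ∧
        TraceOpt.F A (θhat ω) - TraceOpt.F A θstar < ε := by
  -- the event on which `θ` may be preferred to `θstar` although its trace is larger by `ε`
  let bad : EuclideanSpace ℝ (Fin K) → Set Ω := fun θ =>
    {ω | N * ε ≤ ∑ i, w i ω ⬝ᵥ (TraceOpt.offDiag (A θstar) -
      TraceOpt.offDiag (A θ)).mulVec (w i ω)}
  let S : Set Ω := {ω | ∀ i j, w i ω j = 1 ∨ w i ω j = -1}
  have hbad : ∀ θ, MeasurableSet (bad θ) := fun θ =>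
    measurableSet_le measurable_const
      (Finset.measurable_sum _ fun i _ => TraceOpt.measurable_quadForm (hw i).measurable _)
  have hSm : MeasurableSet S := by
    have : S = ⋂ i, ⋂ j, {ω | w i ω j = 1} ∪ {ω | w i ω j = -1} := by
      ext ω; simp [S]
    rw [this]
    exact MeasurableSet.iInter fun i => MeasurableSet.iInter fun j =>
      ((hw i).measurable_apply j (measurableSet_singleton 1)).union
        ((hw i).measurable_apply j (measurableSet_singleton (-1)))
  have hS : P.real Sᶜ = 0 := by
    have : ∀ᵐ ω ∂P, ω ∈ S := ae_all_iff.2 fun i => (hw i).ae_eq_one_or_neg_one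
    rw [measureReal_def, show P Sᶜ = 0 from mem_ae_iff.1 this, ENNReal.toReal_zero]
  have hU : P.real (⋃ θ ∈ Θ, bad θ) ≤ δ := by
    have hcard : (Θ.card : ℝ) ≠ 0 := by exact_mod_cast hΘ.card_pos.ne'
    calc _ ≤ ∑ θ ∈ Θ, P.real (bad θ) := measureReal_biUnion_finset_le _ _
      _ ≤ ∑ _θ ∈ Θ, δ / Θ.card := Finset.sum_le_sum fun θ hθ =>
          TraceOpt.measureReal_deviation_le hN hΘ hA hw hindep hε hδ hsample hstar.1 hθ
      _ = δ := by rw [Finset.sum_const, nsmul_eq_mul]; field_simp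
  have hG : MeasurableSet (Sᶜ ∪ ⋃ θ ∈ Θ, bad θ) :=
    hSm.compl.union (Θ.measurableSet_biUnion fun θ _ => hbad θ)
  refine ⟨(Sᶜ ∪ ⋃ θ ∈ Θ, bad θ)ᶜ, hG.compl, ?_, fun ω hω => ?_⟩
  · rw [probReal_compl_eq_one_sub hG]
    linarith [measureReal_union_le (μ := P) Sᶜ (⋃ θ ∈ Θ, bad θ)]
  · obtain ⟨hmem, hmin⟩ := hhat ω
    simp only [Set.mem_compl_iff, Set.mem_union, not_or, not_not, Set.mem_iUnion, not_exists] at hω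
    refine ⟨sub_nonneg.2 (hstar.2 _ hmem), lt_of_not_ge fun hgap => hω.2 _ hmem ?_⟩
    exact TraceOpt.le_sum_quadForm_of_isMinimizer hN hω.1 (hmin _ hstar.1) hgap
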